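/- Let $\mathcal H$ be a finite-dimensional complex Hilbert space with algebra of operators $\mathcal L(\mathcal H)$, and let $\mathcal E:\mathcal L(\mathcal H)\to\mathcal L(\mathcal H)$ be a quantum channel (a completely positive trace-preserving linear map) with operation elements $E_a$ (finitely many), so that $\mathcal E(\rho)=\sum_a E_a\rho E_a^\dagger$. For a linear map $\Phi$ on $\mathcal L(\mathcal H)$ write $\Phi^\dagger$ for the dual map, $\mathrm{Tr}(\Phi^\dagger(X)Y)=\mathrm{Tr}(X\,\Phi(Y))$. Let $P$ be an orthogonal projector on $\mathcal H$ and let $\mathcal A\subseteq\mathcal L(\mathcal H)$ be an algebra of operators closed under Hermitian conjugation (not necessarily containing the identity of $\mathcal H$) with $P\in\mathcal A$. A set $\mathcal S\subseteq\mathcal L(\mathcal H)$ is said to be conserved by $\Phi$ for states in $P\mathcal H$ if $P\,\Phi^\dagger(X)\,P=PXP$ for all $X\in\mathcal S$, and correctable for $\mathcal E$ on states in $P\mathcal H$ if there is a quantum channel $\mathcal R$ on $\mathcal L(\mathcal H)$ such that $\mathcal S$ is conserved by $\mathcal R\circ\mathcal E$ for states in $P\mathcal H$. Then the following are equivalent: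 1. $\mathcal A$ is correctable for $\mathcal E$ on states in $P\mathcal H$; 2. $[P E_a^\dagger E_b P,\,X]=0$ for all $X\in P\mathcal A P=\{PYP : Y\in\mathcal A\}$ and all $a,b$. Moreover, when these conditions hold, the correction channel $\mathcal R$ can be chosen so that the code is repeatable: $\mathcal A$ is conserved by $\mathcal R\circ\mathcal E$ for states in $P\mathcal H$; every operator $\rho$ with $\rho=P\rho P$ satisfies $(\mathcal R\circ\mathcal E)(\rho)=P\,(\mathcal R\circ\mathcal E)(\rho)\,P$; for every $n\ge 0$, $\mathcal A$ is conserved by $(\mathcal R\circ\mathcal E)^n$ for states in $P\mathcal H$; and, if $P\neq 0$, $\mathcal R^\dagger(X)=\mathcal R^\dagger(PXP)$ for all $X\in\mathcal L(\mathcal H)$. -/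

import Mathlib

noncomputable section

namespace OAQEC

variable {H : Type*} [NormedAddCommGroup H] [InnerProductSpace ℂ H]

/-- The trace of an operator on `H`. -/
def tr (X : H →L[ℂ] H) : ℂ := LinearMap.trace ℂ H (X : H →ₗ[ℂ] H)

variable (H) in
/-- The trace pairing `(X, Y) ↦ Tr (X Y)` on the operators on `H`. -/
def tracePairing : LinearMap.BilinForm ℂ (H →L[ℂ] H) :=
  LinearMap.mk₂ ℂ (fun X Y => tr (X * Y))
    (fun X X' Y => by simp [tr, add_mul])
    (fun c X Y => by simp [tr])
    (fun X Y Y' => by simp [tr, mul_add])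
    (fun c X Y => by simp [tr])

theorem tr_mul_comm (X Y : H →L[ℂ] H) : tr (X * Y) = tr (Y * X) :=
  LinearMap.trace_mul_comm ℂ (X : H →ₗ[ℂ] H) (Y : H →ₗ[ℂ] H)

variable [FiniteDimensional ℂ H]

theorem tr_mul_rankOne (X : H →L[ℂ] H) (u v : H) :
    tr (X * InnerProductSpace.rankOne ℂ u v) = inner ℂ v (X u) := by
  have h : X * InnerProductSpace.rankOne ℂ u v = InnerProductSpace.rankOne ℂ (X u) v := by
    ext z
    simp
  rw [h, tr, InnerProductSpace.trace_rankOne]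

theorem tracePairing_nondegenerate : (tracePairing H).Nondegenerate := by
  have key : ∀ X : H →L[ℂ] H, (∀ Y, tr (X * Y) = 0) → X = 0 := by
    intro X hX
    ext u
    have h := hX (InnerProductSpace.rankOne ℂ u (X u))
    rw [tr_mul_rankOne] at h
    simpa using h
  exact ⟨fun X hX => key X hX, fun X hX => key X fun Y => (tr_mul_comm X Y).trans (hX Y)⟩

/-- The dual of a linear map on operators for the trace pairing:
`Tr (Φ†(X) Y) = Tr (X Φ(Y))` for all `X`, `Y`. For maps that preserve Hermitian conjugation, such
as channels, it is the adjoint for the Hilbert-Schmidt inner product `Tr (X† Y)`. -/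
def dual (Φ : (H →L[ℂ] H) →ₗ[ℂ] (H →L[ℂ] H)) : (H →L[ℂ] H) →ₗ[ℂ] (H →L[ℂ] H) :=
  LinearMap.BilinForm.leftAdjointOfNondegenerate (tracePairing H) tracePairing_nondegenerate Φ

theorem tr_dual_mul (Φ : (H →L[ℂ] H) →ₗ[ℂ] (H →L[ℂ] H)) (X Y : H →L[ℂ] H) :
    tr (dual Φ X * Y) = tr (X * Φ Y) :=
  LinearMap.BilinForm.isAdjointPairLeftAdjointOfNondegenerate (tracePairing H)
    tracePairing_nondegenerate Φ X Y

variable [CompleteSpace H]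

variable (H) in
/-- A quantum channel (in the Schrödinger picture): a completely positive trace-preserving linear
map on the operators on `H`. -/
structure QuantumChannel extends CompletelyPositiveMap (H →L[ℂ] H) (H →L[ℂ] H) where
  trace_preserving : ∀ X : H →L[ℂ] H, tr (toLinearMap X) = tr X

/-- The operators `E a` are operation elements (noise operators) for the channel `𝓔`:
`𝓔(ρ) = ∑ₐ Eₐ ρ Eₐ†`. -/
def IsOperationElements {ι : Type*} [Fintype ι] (E : ι → (H →L[ℂ] H)) (𝓔 : QuantumChannel H) :
    Prop :=
  ∀ ρ : H →L[ℂ] H, 𝓔.toLinearMap ρ = ∑ a, E a * ρ * star (E a)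

/-- The set `S` of operators is conserved by `Φ` for states in the range of the projector `P`:
`P Φ†(X) P = P X P` for all `X ∈ S`. -/
def IsConserved (Φ : (H →L[ℂ] H) →ₗ[ℂ] (H →L[ℂ] H)) (P : H →L[ℂ] H) (S : Set (H →L[ℂ] H)) :
    Prop :=
  ∀ X ∈ S, P * dual Φ X * P = P * X * P

/-- The set `S` of operators is correctable for `𝓔` on states in the range of the projector `P`:
`S` is conserved by `𝓡 ∘ 𝓔` for some channel `𝓡`. -/
def IsCorrectable (𝓔 : QuantumChannel H) (P : H →L[ℂ] H) (S : Set (H →L[ℂ] H)) : Prop :=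
  ∃ 𝓡 : QuantumChannel H, IsConserved (𝓡.toLinearMap ∘ₗ 𝓔.toLinearMap) P S

/-- `Φ` acts repeatably on the code given by the projector `P` and the set `S` of operators:
operators supported in `P H` are mapped to operators supported in `P H`, and `S` is conserved by
every number of repetitions of `Φ`. -/
def IsRepeatable (Φ : (H →L[ℂ] H) →ₗ[ℂ] (H →L[ℂ] H)) (P : H →L[ℂ] H) (S : Set (H →L[ℂ] H)) :
    Prop :=
  (∀ ρ : H →L[ℂ] H, P * ρ * P = ρ → P * Φ ρ * P = Φ ρ) ∧
    ∀ n : ℕ, IsConserved (Φ ^ n) P S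

end OAQEC

end

namespace OAQEC

open InnerProductSpace

/-! Necessity (`commute_of_isCorrectable`): let `R k` be operation elements of a correction, `G = R
k * E a * P` and `X = P * Y * P`. As `X` and `X†X` both lie in the algebra and are conserved, `∑ (GX
- XG)†(GX - XG) = 0`, so every `G` commutes with `X`. Since `∑ R k† R k = 1`, `P Eₐ† E_b P` is a sum
of products `G†G'`, hence commutes with `X`.

Sufficiency (`exists_correction`): put `D = ∑ Eₐ P Eₐ†` and `T = D^(-1/2)` on the support of `D`.
The correction has elements `P Eₐ† T`, completed off that support. With `C = ∑ Eₐ X Eₐ†`, the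
commutation condition gives `C E_c P = D E_c X`. Hence `T` commutes with `C` and `T C T E_c P = E_c
X`; summing against `P E_c†` returns `X`. All correction elements have range in `P H`, which yields
repeatability (`isRepeatable_of_dual_eq`). -/

theorem exists_eq_star_mul_self {A : Type*} [NonUnitalCStarAlgebra A] [PartialOrder A]
    [StarOrderedRing A] {a : A} (ha : 0 ≤ a) : ∃ b, a = star b * b :=
  CStarAlgebra.nonneg_iff_eq_star_mul_self.1 ha

/-! ### Positivity and functional calculus in C⋆-algebras -/

section Algebra

variable {A : Type*} [CStarAlgebra A] [PartialOrder A] [StarOrderedRing A]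

theorem eq_zero_of_sum_star_mul_self_eq_zero {κ : Type*} [Fintype κ] {f : κ → A}
    (h : ∑ k, star (f k) * f k = 0) (k : κ) : f k = 0 := by
  have := (Finset.sum_eq_zero_iff_of_nonneg fun i _ => star_mul_self_nonneg (f i)).1 h k
    (Finset.mem_univ k)
  exact CStarRing.star_mul_self_eq_zero_iff _ |>.1 this

theorem eq_zero_of_sum_mul_star_self_eq_zero {κ : Type*} [Fintype κ] {f : κ → A}
    (h : ∑ k, f k * star (f k) = 0) (k : κ) : f k = 0 := by
  have := eq_zero_of_sum_star_mul_self_eq_zero (f := fun k => star (f k)) (by simpa using h) k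
  simpa using this

/-- Conjugations `X ↦ K X K†` preserve positivity of matrices with operator entries. -/
theorem cstarMatrix_conj_nonneg {k : ℕ} (K : A) {M : CStarMatrix (Fin k) (Fin k) A} (hM : 0 ≤ M) :
    0 ≤ M.map fun X => K * X * star K := by
  let V : CStarMatrix (Fin k) (Fin k) A := CStarMatrix.ofMatrix (Matrix.diagonal fun _ => K)
  have h : M.map (fun X => K * X * star K) = V * M * star V := by
    ext i j
    simp [V, CStarMatrix.mul_apply, CStarMatrix.star_apply, Matrix.diagonal_apply, apply_ite star]
  rw [h]
  exact star_right_conjugate_nonneg hM V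

/-- An isometry on a code conserving a `*`-closed set of operators intertwines these operators. -/
theorem intertwine_of_conserved {κ : Type*} [Fintype κ] {G : κ → A} {P X : A}
    (hPX : P * X = X) (h1 : ∑ k, star (G k) * G k = P) (hX : ∑ k, star (G k) * X * G k = X)
    (hXX : ∑ k, star (G k) * (star X * X) * G k = star X * X) (k : κ) :
    G k * X = X * G k := by
  have hX' : ∑ k, star (G k) * star X * G k = star X := by
    have := congrArg star hX
    simpa [star_sum, mul_assoc] using this
  -- The square expands to `X†PX - X†X - X†X + X†X`, and `PX = X`.
  have h : ∑ k, star (G k * X - X * G k) * (G k * X - X * G k) = 0 := by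
    have : ∀ k, star (G k * X - X * G k) * (G k * X - X * G k)
        = star X * (star (G k) * G k) * X - star X * (star (G k) * X * G k)
          - (star (G k) * star X * G k) * X + star (G k) * (star X * X) * G k := by
      intro k
      simp only [star_sub, star_mul]
      noncomm_ring
    simp only [this, Finset.sum_add_distrib, Finset.sum_sub_distrib, ← Finset.mul_sum,
      ← Finset.sum_mul, h1, hX, hX', hXX]
    rw [mul_assoc, hPX]
    abel
  exact sub_eq_zero.1 (eq_zero_of_sum_star_mul_self_eq_zero h k)

/-- A self-adjoint inverse square root of a positive element with finite spectrum, on the support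
of that element. -/
theorem exists_inv_sqrt {D : A} (hD : 0 ≤ D) (hfin : (spectrum ℝ D).Finite) :
    ∃ T : A, star T = T ∧ IsStarProjection (T * D * T) ∧ T * D * T * D = D ∧
      ∀ C, Commute D C → Commute T C := by
  have hsa : IsSelfAdjoint D := hD.isSelfAdjoint
  -- A finite spectrum is discrete, so the calculus accepts functions discontinuous at `0`. The
  -- convention `0⁻¹ = 0` makes `f` vanish on the kernel of `D`.
  have hc : ∀ f : ℝ → ℝ, ContinuousOn f (spectrum ℝ D) := fun f => hfin.continuousOn f
  set f : ℝ → ℝ := fun x => (√x)⁻¹ with hf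
  have hid : cfc (fun x : ℝ => x) D = D := cfc_id' ℝ D
  have hTDT : cfc f D * D * cfc f D = cfc (fun x => f x * x * f x) D := by
    rw [cfc_mul (fun x => f x * x) f D (hc _) (hc _), cfc_mul f (fun x => x) D (hc _) (hc _), hid]
  have hpos : ∀ x ∈ spectrum ℝ D, 0 ≤ x := fun x hx => spectrum_nonneg_of_nonneg hD hx
  have hval : ∀ x ∈ spectrum ℝ D, f x * x * f x = if x = 0 then 0 else 1 := by
    intro x hx
    split_ifs with h0
    · simp [h0]
    · have : √x ≠ 0 := (Real.sqrt_ne_zero (hpos x hx)).2 h0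
      simp only [hf]
      field_simp
      exact (Real.sq_sqrt (hpos x hx)).symm
  refine ⟨cfc f D, (cfc_predicate f D).star_eq, ?_, ?_, ?_⟩
  · rw [hTDT]
    refine ⟨?_, cfc_predicate _ D⟩
    rw [IsIdempotentElem, ← cfc_mul _ _ D (hc _) (hc _)]
    refine cfc_congr fun x hx => ?_
    simp only [hval x hx]
    split_ifs <;> simp
  · rw [hTDT]
    conv_lhs => enter [2]; rw [← hid]
    rw [← cfc_mul _ _ D (hc _) (hc _)]
    conv_rhs => rw [← hid]
    refine cfc_congr fun x hx => ?_
    simp only [hval x hx]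
    split_ifs with h0 <;> simp [h0]
  · intro C hC
    exact hsa.commute_cfc hC f

end Algebra

/-! ### Rank-one operators and operation elements -/

section Hilbert

variable {H : Type*} [NormedAddCommGroup H] [InnerProductSpace ℂ H]

theorem tr_sum {κ : Type*} [Fintype κ] (f : κ → (H →L[ℂ] H)) : tr (∑ k, f k) = ∑ k, tr (f k) := by
  simp [tr]

theorem mul_rankOne (X : H →L[ℂ] H) (x y : H) : X * rankOne ℂ x y = rankOne ℂ (X x) y :=
  comp_rankOne x y X

theorem rankOne_mul_rankOne {n : Type*} [Fintype n] [DecidableEq n] (b : OrthonormalBasis n ℂ H)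
    (i j k l : n) : rankOne ℂ (b i) (b j) * rankOne ℂ (b k) (b l)
      = if j = k then rankOne ℂ (b i) (b l) else 0 := by
  rw [mul_rankOne, rankOne_apply, b.inner_eq_ite]
  split_ifs <;> simp

theorem sum_rankOne_eq_one {n : Type*} [Fintype n] (b : OrthonormalBasis n ℂ H) :
    ∑ i, rankOne ℂ (b i) (b i) = (1 : H →L[ℂ] H) :=
  b.sum_rankOne_eq_id

variable [CompleteSpace H]

theorem star_rankOne (x y : H) : star (rankOne ℂ x y) = rankOne ℂ y x :=
  InnerProductSpace.adjoint_rankOne x y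

theorem rankOne_mul (x y : H) (X : H →L[ℂ] H) : rankOne ℂ x y * X = rankOne ℂ x (star X y) :=
  rankOne_comp x y X

theorem exists_unit_of_projection_ne_zero {P : H →L[ℂ] H} (hP : IsStarProjection P)
    (h0 : P ≠ 0) : ∃ u : H, ‖u‖ = 1 ∧ P u = u := by
  obtain ⟨v, hv⟩ : ∃ v, P v ≠ 0 := by
    by_contra! h
    exact h0 (ContinuousLinearMap.ext h)
  refine ⟨(‖P v‖⁻¹ : ℂ) • P v, by simp [norm_smul, hv], ?_⟩
  rw [map_smul]
  congr 1
  exact congrArg (fun T : H →L[ℂ] H => T v) hP.isIdempotentElem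

/-- The matrix of matrix units is positive. -/
theorem matrixUnits_nonneg {n : Type*} [Fintype n] (b : OrthonormalBasis n ℂ H) :
    0 ≤ (CStarMatrix.ofMatrix fun i j => rankOne ℂ (b i) (b j) :
      CStarMatrix n n (H →L[ℂ] H)) := by
  classical
  cases isEmpty_or_nonempty n with
  | inl h => exact le_of_eq (by ext1 i; exact h.elim i)
  | inr h =>
    obtain ⟨o⟩ := h
    -- Only row `o` is nonzero, so each entry of `V†V` is a single product of matrix units through
    -- `b o`.
    let V : CStarMatrix n n (H →L[ℂ] H) :=
      CStarMatrix.ofMatrix fun i j => if i = o then rankOne ℂ (b o) (b j) else 0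
    have hV : (CStarMatrix.ofMatrix fun i j => rankOne ℂ (b i) (b j) :
      CStarMatrix n n (H →L[ℂ] H)) = star V * V := by
      ext1 i j
      rw [CStarMatrix.mul_apply]
      change rankOne ℂ (b i) (b j) = ∑ x, star (if x = o then rankOne ℂ (b o) (b i) else 0)
        * (if x = o then rankOne ℂ (b o) (b j) else 0)
      simp [apply_ite star, star_rankOne, rankOne_mul_rankOne]
    rw [hV]
    exact star_mul_self_nonneg V

/-- **Choi's theorem**: every channel has operation elements. -/
theorem exists_isOperationElements {n : Type*} [Fintype n] (b : OrthonormalBasis n ℂ H)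
    (𝓔 : QuantumChannel H) : ∃ K : n × n → (H →L[ℂ] H), IsOperationElements K 𝓔 := by
  classical
  obtain ⟨N, hN⟩ := exists_eq_star_mul_self
    (𝓔.toCompletelyPositiveMap.map_cstarMatrix_nonneg _ (matrixUnits_nonneg b))
  have hent : ∀ i j, 𝓔.toLinearMap (rankOne ℂ (b i) (b j)) = ∑ k, star (N k i) * N k j := by
    intro i j
    have := congrFun (congrFun hN i) j
    rw [CStarMatrix.mul_apply] at this
    exact this
  -- Chosen so that `K (k, m)` sends `b i` to `(N k i)† (b m)`; summing over `m` then inserts the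
  -- identity between `(N k i)†` and `N k j`.
  let K : n × n → (H →L[ℂ] H) := fun km =>
    ∑ i, rankOne ℂ (star (N km.1 i) (b km.2)) (b i)
  have hK : ∀ km i, K km (b i) = star (N km.1 i) (b km.2) := by
    intro km i
    simp [K, b.inner_eq_ite]
  refine ⟨K, fun ρ => ?_⟩
  have hbasis : ∀ i j, 𝓔.toLinearMap (rankOne ℂ (b i) (b j))
      = ∑ km, K km * rankOne ℂ (b i) (b j) * star (K km) := by
    intro i j
    have h1 : ∀ km, K km * rankOne ℂ (b i) (b j) * star (K km)
        = star (N km.1 i) * rankOne ℂ (b km.2) (b km.2) * N km.1 j := by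
      intro km
      rw [mul_rankOne, rankOne_mul, star_star, hK, hK, mul_rankOne, rankOne_mul]
    rw [hent, Fintype.sum_prod_type]
    refine Finset.sum_congr rfl fun k _ => ?_
    simp only [h1]
    rw [← Finset.sum_mul, ← Finset.mul_sum, sum_rankOne_eq_one, mul_one]
  have hρ : ρ = ∑ i, ∑ j, inner ℂ (b i) (ρ (b j)) • rankOne ℂ (b i) (b j) := by
    calc ρ = (∑ i, rankOne ℂ (b i) (b i)) * ρ * ∑ j, rankOne ℂ (b j) (b j) := by
          rw [sum_rankOne_eq_one, one_mul, mul_one]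
      _ = _ := by
          simp only [Finset.sum_mul, Finset.mul_sum, mul_assoc, mul_rankOne, rankOne_apply]
          rw [Finset.sum_comm]
          simp
  let Ψ : (H →L[ℂ] H) →ₗ[ℂ] (H →L[ℂ] H) :=
    ∑ km, LinearMap.mulRight ℂ (star (K km)) ∘ₗ LinearMap.mulLeft ℂ (K km)
  have hΨ : ∀ X, Ψ X = ∑ km, K km * X * star (K km) := fun X => by simp [Ψ]
  rw [← hΨ, hρ]
  simp only [map_sum, map_smul, hbasis, ← hΨ]

end Hilbert

/-! ### Dual maps and channels given by operation elements -/

variable {H : Type*} [NormedAddCommGroup H] [InnerProductSpace ℂ H] [FiniteDimensional ℂ H]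

theorem eq_of_tr_mul_eq {X X' : H →L[ℂ] H} (h : ∀ Y, tr (X * Y) = tr (X' * Y)) : X = X' := by
  rw [← sub_eq_zero]
  refine tracePairing_nondegenerate.1 _ fun Y => ?_
  change tr ((X - X') * Y) = 0
  have : tr (X * Y - X' * Y) = tr (X * Y) - tr (X' * Y) := by simp [tr]
  rw [sub_mul, this, h, sub_self]

theorem dual_comp (Φ Ψ : (H →L[ℂ] H) →ₗ[ℂ] (H →L[ℂ] H)) (X : H →L[ℂ] H) :
    dual (Φ ∘ₗ Ψ) X = dual Ψ (dual Φ X) :=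
  eq_of_tr_mul_eq fun Y => by simp [tr_dual_mul]

/-- By duality `hΦ` says that all outputs of `Φ` are supported in `P H`. It also lets the
compression by `P` be inserted between successive applications of the dual, so conservation
iterates. -/
theorem isRepeatable_of_dual_eq {Φ : (H →L[ℂ] H) →ₗ[ℂ] (H →L[ℂ] H)} {P : H →L[ℂ] H}
    {S : Set (H →L[ℂ] H)} (hΦ : ∀ X, dual Φ X = dual Φ (P * X * P)) (hS : IsConserved Φ P S) :
    IsRepeatable Φ P S := by
  refine ⟨fun ρ _ => eq_of_tr_mul_eq fun Y => ?_, fun n => ?_⟩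
  · rw [tr_mul_comm _ Y, tr_mul_comm _ Y, ← tr_dual_mul Φ Y, hΦ, tr_dual_mul, ← mul_assoc,
      tr_mul_comm]
    simp only [mul_assoc]
  · induction n with
    | zero =>
      intro X _
      have : dual (Φ ^ 0) X = X := eq_of_tr_mul_eq fun Y => by simp [tr_dual_mul]
      rw [this]
    | succ n ih =>
      intro X hX
      rw [pow_succ, Module.End.mul_eq_comp, dual_comp, hΦ, ih X hX, ← hΦ, hS X hX]

theorem finite_real_spectrum (D : H →L[ℂ] H) : (spectrum ℝ D).Finite := by
  have h : (spectrum ℂ D).Finite := by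
    rw [← AlgEquiv.spectrum_eq (Module.End.toContinuousLinearMap H).symm D]
    exact Module.End.finite_spectrum _
  rw [← spectrum.preimage_algebraMap ℂ]
  exact h.preimage (FaithfulSMul.algebraMap_injective ℝ ℂ).injOn

variable [CompleteSpace H]

theorem dual_eq_sum {κ : Type*} [Fintype κ] {K : κ → (H →L[ℂ] H)}
    {Φ : (H →L[ℂ] H) →ₗ[ℂ] (H →L[ℂ] H)} (h : ∀ ρ, Φ ρ = ∑ k, K k * ρ * star (K k))
    (X : H →L[ℂ] H) : dual Φ X = ∑ k, star (K k) * X * K k := by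
  refine eq_of_tr_mul_eq fun Y => ?_
  rw [tr_dual_mul, h, Finset.mul_sum, Finset.sum_mul, tr_sum, tr_sum]
  refine Finset.sum_congr rfl fun k _ => ?_
  rw [← mul_assoc, tr_mul_comm]
  simp only [mul_assoc]

theorem sum_star_mul_self_eq_one {κ : Type*} [Fintype κ] {K : κ → (H →L[ℂ] H)}
    {𝓔 : QuantumChannel H} (h : IsOperationElements K 𝓔) : ∑ k, star (K k) * K k = 1 := by
  have h1 := dual_eq_sum h 1
  simp only [mul_one] at h1
  rw [← h1]
  refine eq_of_tr_mul_eq fun Y => ?_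
  rw [tr_dual_mul, one_mul, 𝓔.trace_preserving, one_mul]

/-- The channel with given operation elements. -/
noncomputable def ofOperationElements {κ : Type*} [Fintype κ] (K : κ → (H →L[ℂ] H))
    (hK : ∑ k, star (K k) * K k = 1) : QuantumChannel H where
  toFun ρ := ∑ k, K k * ρ * star (K k)
  map_add' X Y := by simp [mul_add, add_mul, Finset.sum_add_distrib]
  map_smul' c X := by simp [Finset.smul_sum]
  map_cstarMatrix_nonneg' n M hM := by
    have h : M.map (fun ρ => ∑ k, K k * ρ * star (K k))
        = ∑ k, M.map fun ρ => K k * ρ * star (K k) := by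
      ext1 i j
      have hs : ∀ s : Finset κ, (∑ k ∈ s, M.map fun ρ => K k * ρ * star (K k)) i j
          = ∑ k ∈ s, K k * M i j * star (K k) := by
        intro s
        classical
        induction s using Finset.induction_on with
        | empty => simp
        | insert a s ha ih => simp [Finset.sum_insert ha, ih]
      rw [hs]
      rfl
    change 0 ≤ M.map (fun ρ => ∑ k, K k * ρ * star (K k))
    rw [h]
    exact Finset.sum_nonneg fun k _ => cstarMatrix_conj_nonneg (K k) hM
  trace_preserving X := by
    change tr (∑ k, K k * X * star (K k)) = tr X
    have : ∀ k, tr (K k * X * star (K k)) = tr (star (K k) * K k * X) := fun k => by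
      rw [tr_mul_comm, mul_assoc]
    rw [tr_sum]
    simp only [this]
    rw [← tr_sum, ← Finset.sum_mul, hK, one_mul]

/-! ### Correctability and the commutation condition -/

theorem commute_of_isCorrectable {ι : Type*} [Fintype ι] {𝓔 : QuantumChannel H}
    {E : ι → (H →L[ℂ] H)} (hE : IsOperationElements E 𝓔) {P : H →L[ℂ] H}
    (hP : IsStarProjection P) {A : NonUnitalStarSubalgebra ℂ (H →L[ℂ] H)} (hPA : P ∈ A)
    (h : IsCorrectable 𝓔 P (A : Set (H →L[ℂ] H))) {Y : H →L[ℂ] H} (hY : Y ∈ A) (a b : ι) :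
    Commute (P * star (E a) * E b * P) (P * Y * P) := by
  obtain ⟨𝓡, h𝓡⟩ := h
  obtain ⟨R, hR⟩ := exists_isOperationElements (stdOrthonormalBasis ℂ H) 𝓡
  have hPP : P * P = P := hP.isIdempotentElem
  have hPs : star P = P := hP.isSelfAdjoint
  let G : (_ × ι) → (H →L[ℂ] H) := fun ka => R ka.1 * E ka.2 * P
  have hcons : ∀ X ∈ A, ∑ ka, star (G ka) * X * G ka = P * X * P := by
    intro X hX
    rw [← h𝓡 X hX, dual_comp, dual_eq_sum hR, dual_eq_sum hE, Fintype.sum_prod_type_right]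
    simp only [Finset.mul_sum, Finset.sum_mul, G, star_mul, hPs, mul_assoc]
  have hR1 := sum_star_mul_self_eq_one hR
  have hE1 := sum_star_mul_self_eq_one hE
  have hG1 : ∑ ka, star (G ka) * G ka = P := by
    have : ∀ a, ∑ k, star (G (k, a)) * G (k, a) = P * (star (E a) * E a) * P := by
      intro a
      calc _ = P * star (E a) * (∑ k, star (R k) * R k) * E a * P := by
            simp only [Finset.mul_sum, Finset.sum_mul, G, star_mul, hPs, mul_assoc]
        _ = _ := by rw [hR1, mul_one]; simp only [mul_assoc]
    rw [Fintype.sum_prod_type_right]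
    simp only [this]
    rw [← Finset.sum_mul, ← Finset.mul_sum, hE1, mul_one, hPP]
  have key : ∀ Y ∈ A, ∀ ka, G ka * (P * Y * P) = (P * Y * P) * G ka := by
    intro Y hY ka
    have hX : P * Y * P ∈ A := mul_mem (mul_mem hPA hY) hPA
    refine intertwine_of_conserved (by simp only [← mul_assoc, hPP]) hG1 ?_ ?_ ka
    · rw [hcons _ hX]
      simp only [← mul_assoc, hPP]
      simp only [mul_assoc, hPP]
    · rw [hcons _ (mul_mem (star_mem hX) hX)]
      simp only [star_mul, hPs, ← mul_assoc, hPP]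
      simp only [mul_assoc, hPP]
  have hsum : P * star (E a) * E b * P = ∑ k, star (G (k, a)) * G (k, b) := by
    calc _ = P * star (E a) * (∑ k, star (R k) * R k) * E b * P := by rw [hR1, mul_one]
      _ = _ := by simp only [Finset.mul_sum, Finset.sum_mul, G, star_mul, hPs, mul_assoc]
  rw [hsum]
  refine Commute.sum_left _ _ _ fun k _ => ?_
  -- Intertwining for `Y†`, after taking adjoints, moves `P * Y * P` past `(G (k, a))†`.
  have h2 := congrArg star (key (star Y) (star_mem hY) (k, a))
  simp only [star_mul, star_star, hPs] at h2
  change star (G (k, a)) * G (k, b) * (P * Y * P) = P * Y * P * (star (G (k, a)) * G (k, b))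
  rw [mul_assoc, key Y hY, ← mul_assoc, ← mul_assoc (P * Y * P)]
  congr 1
  simpa only [mul_assoc] using h2.symm

/-- The transpose channel of the code, completed to a trace-preserving map, corrects every algebra
that commutes with the operators `P Eₐ† E_b P`. -/
theorem exists_correction {ι : Type*} [Fintype ι] {𝓔 : QuantumChannel H}
    {E : ι → (H →L[ℂ] H)} (hE : IsOperationElements E 𝓔) {P : H →L[ℂ] H}
    (hP : IsStarProjection P) (h0 : P ≠ 0) {S : Set (H →L[ℂ] H)}
    (hS : ∀ Y ∈ S, ∀ a b, Commute (P * star (E a) * E b * P) (P * Y * P)) :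
    ∃ 𝓡 : QuantumChannel H, IsConserved (𝓡.toLinearMap ∘ₗ 𝓔.toLinearMap) P S ∧
      ∀ X, dual 𝓡.toLinearMap X = dual 𝓡.toLinearMap (P * X * P) := by
  have hPP : P * P = P := hP.isIdempotentElem
  have hPs : star P = P := hP.isSelfAdjoint
  have hE1 := sum_star_mul_self_eq_one hE
  obtain ⟨u, hu, hPu⟩ := exists_unit_of_projection_ne_zero hP h0
  set D : H →L[ℂ] H := ∑ a, E a * P * star (E a) with hD
  have hDsq : D = ∑ a, (E a * P) * star (E a * P) := by
    simp only [hD, star_mul, hPs, mul_assoc]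
    simp only [← mul_assoc P P, hPP]
  have hDpos : 0 ≤ D := by
    rw [hDsq]
    exact Finset.sum_nonneg fun a _ => mul_star_self_nonneg _
  obtain ⟨T, hTs, hQ, hQD, hTcomm⟩ := exists_inv_sqrt hDpos (finite_real_spectrum D)
  set Q : H →L[ℂ] H := T * D * T with hQdef
  have hQs : star Q = Q := hQ.isSelfAdjoint
  have hQQ : Q * Q = Q := hQ.isIdempotentElem
  -- The range of `E a * P` lies in the support of `D`, because `(1 - Q) D (1 - Q) = 0` is a sum of
  -- positive terms.
  have hQE : ∀ a, Q * (E a * P) = E a * P := by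
    intro a
    have : ∑ a, ((1 - Q) * (E a * P)) * star ((1 - Q) * (E a * P)) = 0 := by
      have h1 : ∀ a, ((1 - Q) * (E a * P)) * star ((1 - Q) * (E a * P))
          = (1 - Q) * ((E a * P) * star (E a * P)) * star (1 - Q) := by
        intro a
        rw [star_mul]
        simp only [mul_assoc]
      simp only [h1]
      rw [← Finset.sum_mul, ← Finset.mul_sum, ← hDsq, sub_mul, one_mul, hQD, sub_self, zero_mul]
    have := eq_zero_of_sum_mul_star_self_eq_zero this a
    rw [sub_mul, one_mul, sub_eq_zero] at this
    exact this.symm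
  let b := stdOrthonormalBasis ℂ H
  -- The second family sends the complement of the support of `D` to the code vector `u`: this
  -- restores trace preservation and keeps all ranges inside `P H`.
  let K : ι ⊕ Fin (Module.finrank ℂ H) → (H →L[ℂ] H) :=
    Sum.elim (fun a => P * star (E a) * T) (fun m => rankOne ℂ u (b m) * (1 - Q))
  have hinl : ∀ X a, star (K (.inl a)) * X * K (.inl a)
      = T * (E a * (P * X * P) * star (E a)) * T := by
    intro X a
    simp only [K, Sum.elim_inl, star_mul, star_star, hPs, hTs, mul_assoc]
  have hinr : ∀ X m, star (K (.inr m)) * X * K (.inr m)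
      = (1 - Q) * (rankOne ℂ (b m) u * X * rankOne ℂ u (b m)) * (1 - Q) := by
    intro X m
    simp only [K, Sum.elim_inr, star_mul, star_sub, star_one, hQs, star_rankOne, mul_assoc]
  have hK : ∑ k, star (K k) * K k = 1 := by
    have h1 : ∑ a, star (K (.inl a)) * K (.inl a) = Q := by
      have : ∀ a, star (K (.inl a)) * K (.inl a) = T * (E a * P * star (E a)) * T := by
        intro a
        have := hinl 1 a
        rwa [mul_one, mul_one, hPP] at this
      simp only [this]
      rw [← Finset.sum_mul, ← Finset.mul_sum]
    have h2 : ∑ m, star (K (.inr m)) * K (.inr m) = 1 - Q := by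
      have : ∀ m, star (K (.inr m)) * K (.inr m) = (1 - Q) * rankOne ℂ (b m) (b m) * (1 - Q) := by
        intro m
        have := hinr 1 m
        rw [mul_one, mul_one, mul_rankOne] at this
        simpa [hu] using this
      simp only [this]
      rw [← Finset.sum_mul, ← Finset.mul_sum, sum_rankOne_eq_one, mul_one]
      simp [mul_sub, sub_mul, hQQ]
    rw [Fintype.sum_sum_type, h1, h2, add_sub_cancel]
  have hop : IsOperationElements K (ofOperationElements K hK) := fun _ => rfl
  have hdual : ∀ X, dual (ofOperationElements K hK).toLinearMap X
      = dual (ofOperationElements K hK).toLinearMap (P * X * P) := by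
    intro X
    rw [dual_eq_sum hop, dual_eq_sum hop]
    refine Finset.sum_congr rfl fun k _ => ?_
    have hPK : P * K k = K k := by
      cases k with
      | inl a => simp only [K, Sum.elim_inl, ← mul_assoc, hPP]
      | inr m => simp only [K, Sum.elim_inr, ← mul_assoc, mul_rankOne, hPu]
    have hKP : star (K k) * P = star (K k) := by
      have := congrArg star hPK
      rwa [star_mul, hPs] at this
    calc star (K k) * X * K k = (star (K k) * P) * X * (P * K k) := by rw [hPK, hKP]
      _ = _ := by simp only [mul_assoc]
  refine ⟨ofOperationElements K hK, fun Y hY => ?_, hdual⟩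
  set X := P * Y * P with hX
  have hPX : P * X = X := by simp only [hX, ← mul_assoc, hPP]
  have hXP : X * P = X := by simp only [hX, mul_assoc, hPP]
  set C : H →L[ℂ] H := ∑ a, E a * X * star (E a) with hC
  have hCE : ∀ c, C * (E c * P) = D * (E c * X) := by
    intro c
    rw [hC, hD, Finset.sum_mul, Finset.sum_mul]
    refine Finset.sum_congr rfl fun a _ => ?_
    have := (hS Y hY a c).eq
    calc E a * X * star (E a) * (E c * P) = E a * (X * P * star (E a) * E c * P) := by
          rw [hXP]; simp only [mul_assoc]
      _ = E a * (X * (P * star (E a) * E c * P)) := by simp only [mul_assoc]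
      _ = E a * (P * star (E a) * E c * P * X) := by rw [this]
      _ = E a * P * star (E a) * (E c * (P * X)) := by simp only [mul_assoc]
      _ = _ := by rw [hPX]
  -- Multiplying `hCE` on the right by `(E c)†` and summing over `c` gives `C D = D C`.
  have hCD : Commute D C := by
    change D * C = C * D
    calc D * C = ∑ a, D * (E a * X) * star (E a) := by
          simp only [hC, Finset.mul_sum, mul_assoc]
      _ = ∑ a, C * (E a * P) * star (E a) := by simp only [hCE]
      _ = C * D := by simp only [hD, Finset.mul_sum, mul_assoc]
  have hTC := hTcomm C hCD
  have hTD := hTcomm D (Commute.refl D)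
  have hTCT : ∀ c, T * C * T * (E c * P) = E c * X := by
    intro c
    calc T * C * T * (E c * P) = T * T * (C * (E c * P)) := by
          rw [mul_assoc T C T, ← hTC.eq]; simp only [mul_assoc]
      _ = T * (T * D) * (E c * X) := by rw [hCE]; simp only [mul_assoc]
      _ = Q * (E c * P * X) := by rw [hTD.eq, mul_assoc (E c), hPX, hQdef]; simp only [mul_assoc]
      _ = E c * X := by rw [← mul_assoc, hQE, mul_assoc, hPX]
  have hQ0 : ∀ c, (1 - Q) * (E c * P) = 0 := fun c => by rw [sub_mul, one_mul, hQE, sub_self]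
  have hrec : ∀ c, dual (ofOperationElements K hK).toLinearMap Y * (E c * P) = E c * X := by
    intro c
    have h2 : ∀ m, star (K (.inr m)) * Y * K (.inr m) * (E c * P) = 0 := by
      intro m
      rw [hinr, mul_assoc, hQ0, mul_zero]
    rw [dual_eq_sum hop, Fintype.sum_sum_type, add_mul, Finset.sum_mul _ _ (E c * P),
      Finset.sum_mul _ _ (E c * P), Finset.sum_eq_zero fun m _ => h2 m, add_zero]
    simp only [hinl]
    rw [← Finset.sum_mul, ← Finset.sum_mul, ← Finset.mul_sum]
    exact hTCT c
  rw [dual_comp, dual_eq_sum hE]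
  calc _ = ∑ c, P * star (E c) * (dual (ofOperationElements K hK).toLinearMap Y * (E c * P)) := by
        simp only [Finset.mul_sum, Finset.sum_mul, mul_assoc]
    _ = P * (∑ c, star (E c) * E c) * X := by
        simp only [hrec, Finset.mul_sum, Finset.sum_mul, mul_assoc]
    _ = X := by rw [hE1, mul_one, hPX]

end OAQEC

theorem theorem4 {H : Type*} [NormedAddCommGroup H] [InnerProductSpace ℂ H] [CompleteSpace H]
    [FiniteDimensional ℂ H] {ι : Type*} [Fintype ι]
    (𝓔 : OAQEC.QuantumChannel H) (E : ι → (H →L[ℂ] H)) (hE : OAQEC.IsOperationElements E 𝓔)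
    (P : H →L[ℂ] H) (hP : IsStarProjection P)
    (A : NonUnitalStarSubalgebra ℂ (H →L[ℂ] H)) (hPA : P ∈ A) :
    (OAQEC.IsCorrectable 𝓔 P (A : Set (H →L[ℂ] H)) ↔
      ∀ X ∈ (fun Y : H →L[ℂ] H => P * Y * P) '' (A : Set (H →L[ℂ] H)), ∀ a b : ι,
        ⁅P * star (E a) * E b * P, X⁆ = 0) ∧
    (OAQEC.IsCorrectable 𝓔 P (A : Set (H →L[ℂ] H)) →
      ∃ 𝓡 : OAQEC.QuantumChannel H,
        OAQEC.IsConserved (𝓡.toLinearMap ∘ₗ 𝓔.toLinearMap) P (A : Set (H →L[ℂ] H)) ∧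
        OAQEC.IsRepeatable (𝓡.toLinearMap ∘ₗ 𝓔.toLinearMap) P (A : Set (H →L[ℂ] H)) ∧
        (P ≠ 0 → ∀ X : H →L[ℂ] H,
          OAQEC.dual 𝓡.toLinearMap X = OAQEC.dual 𝓡.toLinearMap (P * X * P))) := by
  have hnec : OAQEC.IsCorrectable 𝓔 P (A : Set (H →L[ℂ] H)) →
      ∀ Y ∈ (A : Set (H →L[ℂ] H)), ∀ a b,
        Commute (P * star (E a) * E b * P) (P * Y * P) :=
    fun h Y hY a b => OAQEC.commute_of_isCorrectable hE hP hPA h hY a b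
  have hsuf : (∀ Y ∈ (A : Set (H →L[ℂ] H)), ∀ a b,
        Commute (P * star (E a) * E b * P) (P * Y * P)) →
      ∃ 𝓡 : OAQEC.QuantumChannel H,
        OAQEC.IsConserved (𝓡.toLinearMap ∘ₗ 𝓔.toLinearMap) P (A : Set (H →L[ℂ] H)) ∧
        OAQEC.IsRepeatable (𝓡.toLinearMap ∘ₗ 𝓔.toLinearMap) P (A : Set (H →L[ℂ] H)) ∧
        (P ≠ 0 → ∀ X : H →L[ℂ] H,
          OAQEC.dual 𝓡.toLinearMap X = OAQEC.dual 𝓡.toLinearMap (P * X * P)) := by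
    intro h
    by_cases h0 : P = 0
    -- A zero code contains no unit vector for the construction, but every compression vanishes, so
    -- `𝓔` itself serves as the correction.
    · subst h0
      exact ⟨𝓔, fun X _ => by simp, ⟨fun ρ hρ => by
        have : ρ = 0 := by simpa using hρ.symm
        simp [this], fun n X _ => by simp⟩,
        fun h => absurd rfl h⟩
    · obtain ⟨𝓡, hcons, hdual⟩ := OAQEC.exists_correction hE hP h0 h
      refine ⟨𝓡, hcons, OAQEC.isRepeatable_of_dual_eq (fun X => ?_) hcons, fun _ => hdual⟩
      rw [OAQEC.dual_comp, OAQEC.dual_comp, hdual]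
  refine ⟨⟨?_, fun h => ?_⟩, fun h => hsuf (hnec h)⟩
  · rintro h _ ⟨Y, hY, rfl⟩ a b
    exact (commute_iff_lie_eq).1 (hnec h Y hY a b)
  · obtain ⟨𝓡, h𝓡, -⟩ := hsuf fun Y hY a b =>
      (commute_iff_lie_eq).2 (h _ ⟨Y, hY, rfl⟩ a b)
    exact ⟨𝓡, h𝓡⟩
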